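/- Let $M>0$, $l\in\{0,1,2,\dots\}$ and $\omega\in\mathbb{C}\setminus\{0\}$. On $(2M,\infty)$ put $f(r)=1-\frac{2M}{r}$, $f_1(r)=\frac{2M}{r}$, $\mathcal{B}_l=l(l+1)$, $\mathcal{A}_l=(l-1)l(l+1)(l+2)$, $\alpha=(12M\omega)^2+\mathcal{A}_l^2$, and for $s=0,1,2$ let $$\mathcal{D}_s\phi=\partial_r f\partial_r\phi-\frac{1}{r^2}\big[\mathcal{B}_l+(1-s^2)f_1\big]\phi+\frac{\omega^2}{f}\phi$$ be the spin-$s$ Regge–Wheeler operator, regarded as an unbounded operator from $L^2(2M,\infty;\frac{dr}{f})$ to $L^2(2M,\infty;f\,dr)$ with domain all $\phi\in L^2(2M,\infty;\frac{dr}{f})$ whose distributional image $\mathcal{D}_s\phi$ lies in $L^2(2M,\infty;f\,dr)$. Write $g=\frac{f_1}{r^2}\big(\mathcal{B}_l+\frac12 f_1\big)$. Let $\tilde E$ be one of the following triangular Regge–Wheeler systems. (a) $\tilde E=\frac{1}{\omega^2}\mathcal{D}_0$ (scalar), any $l\ge 0$. (b) $\tilde E=\frac{\mathcal{B}_l}{\omega^2}\mathcal{D}_1$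 (vector, odd), with $l\ge1$. (c) (vector, even), with $l\ge1$, $$\tilde E=\frac{1}{\omega^2}\begin{bmatrix}\mathcal{D}_0&0&-g\\0&\mathcal{B}_l\mathcal{D}_1&0\\0&0&\mathcal{D}_0\end{bmatrix}.$$ (d) (Lichnerowicz, odd), with $l\ge2$, $$\tilde E=-\frac{2}{\omega^2}\begin{bmatrix}\mathcal{B}_l\mathcal{D}_1&0&\frac13\mathcal{B}_l^2\frac{f_1}{r^2}\\0&\mathcal{A}_l\mathcal{D}_2&0\\0&0&\mathcal{B}_l\mathcal{D}_1\end{bmatrix}.$$ (e) (Lichnerowicz, even), with $l\ge2$ and $\alpha\neq0$ (that is, $\omega\ne\pm i\frac{\mathcal{A}_l}{12M}$), $$\tilde E=-\frac{2}{\omega^2}\begin{bmatrix} \mathcal{D}_0&0&-g&0&g&0&\frac{f_1^2}{8r^2}(7\mathcal{B}_l+2)\\ 0&\mathcal{B}_l\mathcal{D}_1&0&0&0&-\frac53\mathcal{B}_l^2\frac{f_1}{r^2}&0\\ 0&0&\mathcal{D}_0&0&0&0&g\\ 0&0&0&\alpha\mathcal{A}_l\mathcal{D}_2&0&0&0\\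 0&0&0&0&\mathcal{D}_0&0&-g\\ 0&0&0&0&0&\mathcal{B}_l\mathcal{D}_1&0\\ 0&0&0&0&0&0&\mathcal{D}_0\end{bmatrix}.$$ Let $n$ be the size of $\tilde E$ ($n=1,1,3,3,7$ respectively), and regard $\tilde E$ as an operator matrix from $L^2(2M,\infty;\frac{dr}{f})^{\oplus n}$ to $L^2(2M,\infty;f\,dr)^{\oplus n}$, defined on those $\phi$ whose components lie in the domains of the entries acting on them. If for every spin $s$ occurring on the diagonal of $\tilde E$ the bounded inverse $\mathcal{D}_s^{-1}\colon L^2(2M,\infty;f\,dr)\to L^2(2M,\infty;\frac{dr}{f})$ exists, then the bounded inverse $\tilde E^{-1}\colon L^2(2M,\infty;f\,dr)^{\oplus n}\to L^2(2M,\infty;\frac{dr}{f})^{\oplus n}$ exists. -/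

import Mathlib

noncomputable section

namespace ReggeWheeler

open MeasureTheory Set

/-! Schwarzschild functions and mode parameters -/

/-- `f(r) = 1 - 2M/r`. -/
def f (M r : ℝ) : ℝ := 1 - 2 * M / r

/-- `f₁(r) = r ∂ᵣ f(r) = 2M/r`. -/
def f₁ (M r : ℝ) : ℝ := 2 * M / r

/-- `𝓑_l = l (l + 1)`. -/
def 𝓑 (l : ℕ) : ℂ := (l : ℂ) * ((l : ℂ) + 1)

/-- `𝓐_l = (l - 1) l (l + 1) (l + 2)`. -/
def 𝓐 (l : ℕ) : ℂ := ((l : ℂ) - 1) * (l : ℂ) * ((l : ℂ) + 1) * ((l : ℂ) + 2)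

/-- `α = (12 M ω)² + 𝓐_l²`; its zeros are the algebraically special frequencies. -/
def α (M : ℝ) (l : ℕ) (ω : ℂ) : ℂ := (12 * (M : ℂ) * ω) ^ 2 + 𝓐 l ^ 2

/-! The weighted spaces on `(2M, ∞)` -/

/-- The measure `w(r) dr` on `(2M, ∞)`. -/
def weighted (M : ℝ) (w : ℝ → ℝ) : Measure ℝ :=
  (volume.restrict (Ioi (2 * M))).withDensity fun r => ENNReal.ofReal (w r)

/-- The measure `dr / f` on `(2M, ∞)`. -/
def μdom (M : ℝ) : Measure ℝ := weighted M fun r => (f M r)⁻¹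

/-- The measure `f dr` on `(2M, ∞)`. -/
def μcod (M : ℝ) : Measure ℝ := weighted M fun r => f M r

/-- `L²(2M, ∞; dr / f)`, complex valued. -/
abbrev Dom (M : ℝ) : Type := Lp ℂ 2 (μdom M)

/-- `L²(2M, ∞; f dr)`, complex valued. -/
abbrev Cod (M : ℝ) : Type := Lp ℂ 2 (μcod M)

theorem f_pos {M r : ℝ} (hM : 0 < M) (hr : r ∈ Ioi (2 * M)) : 0 < f M r := by
  have h : 2 * M < r := hr
  have h0 : 0 < r := by linarith
  rw [f, sub_pos, div_lt_one h0]
  exact h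

theorem continuousOn_f {M : ℝ} (hM : 0 < M) : ContinuousOn (f M) (Ioi (2 * M)) := by
  unfold f
  refine continuousOn_const.sub (continuousOn_const.div continuousOn_id fun r hr => ?_)
  have h : 2 * M < r := hr
  exact (by linarith : (0 : ℝ) < r).ne'

theorem weighted_ac (M : ℝ) (w : ℝ → ℝ) : weighted M w ≪ volume.restrict (Ioi (2 * M)) :=
  withDensity_absolutelyContinuous _ _

theorem ac_weighted {M : ℝ} {w : ℝ → ℝ} (hw : ContinuousOn w (Ioi (2 * M)))
    (hpos : ∀ r ∈ Ioi (2 * M), 0 < w r) : volume.restrict (Ioi (2 * M)) ≪ weighted M w := by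
  refine withDensity_absolutelyContinuous' ?_ ?_
  · exact (hw.aemeasurable measurableSet_Ioi).ennreal_ofReal
  · filter_upwards [ae_restrict_mem measurableSet_Ioi] with r hr
    exact (ENNReal.ofReal_pos.2 (hpos r hr)).ne'

theorem ac_dom {M : ℝ} (hM : 0 < M) : volume.restrict (Ioi (2 * M)) ≪ μdom M :=
  ac_weighted ((continuousOn_f hM).inv₀ fun _ hr => (f_pos hM hr).ne')
    fun _ hr => inv_pos.2 (f_pos hM hr)

theorem ac_cod {M : ℝ} (hM : 0 < M) : volume.restrict (Ioi (2 * M)) ≪ μcod M :=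
  ac_weighted (continuousOn_f hM) fun _ hr => f_pos hM hr

theorem integrable_weight_sq {M : ℝ} {w : ℝ → ℝ} (hw : ContinuousOn w (Ioi (2 * M)))
    (hpos : ∀ r ∈ Ioi (2 * M), 0 < w r) {φ : ℝ → ℂ} (hφ : MemLp φ 2 (weighted M w)) :
    IntegrableOn (fun r => w r * ‖φ r‖ ^ 2) (Ioi (2 * M)) := by
  have h1 := hφ.integrable_norm_pow (by norm_num)
  have h2 := (integrable_withDensity_iff_integrable_smul₀'
    (hw.aemeasurable measurableSet_Ioi).ennreal_ofReal (by simp)).1 h1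
  refine h2.congr ?_
  filter_upwards [ae_restrict_mem measurableSet_Ioi] with r hr
  simp [ENNReal.toReal_ofReal (hpos r hr).le]

theorem amgm {w a b : ℝ} (hw : 0 < w) : a * b ≤ a ^ 2 / w + w * b ^ 2 := by
  have h : a ^ 2 / w + w * b ^ 2 - a * b = ((a - w * b) ^ 2 + a ^ 2 + (w * b) ^ 2) / (2 * w) := by
    field_simp; ring
  have : 0 ≤ ((a - w * b) ^ 2 + a ^ 2 + (w * b) ^ 2) / (2 * w) := by positivity
  linarith

/-- Elements of the weighted spaces are integrable against functions that are continuous with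
compact support in `(2M, ∞)`. -/
theorem integrable_mul {M : ℝ} {w : ℝ → ℝ} (hw : ContinuousOn w (Ioi (2 * M)))
    (hpos : ∀ r ∈ Ioi (2 * M), 0 < w r) {φ : ℝ → ℂ} (hφ : MemLp φ 2 (weighted M w))
    {K : Set ℝ} (hK : IsCompact K) (hKs : K ⊆ Ioi (2 * M)) {g : ℝ → ℂ}
    (hg : ContinuousOn g (Ioi (2 * M))) (hg0 : ∀ r ∉ K, g r = 0) :
    IntegrableOn (fun r => g r * φ r) (Ioi (2 * M)) := by
  have hm : AEStronglyMeasurable φ (volume.restrict (Ioi (2 * M))) :=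
    hφ.1.mono_ac (ac_weighted hw hpos)
  have hb : IntegrableOn (fun r => ‖g r‖ ^ 2 / w r) (Ioi (2 * M)) := by
    have hc : ContinuousOn (fun r => ‖g r‖ ^ 2 / w r) (Ioi (2 * M)) :=
      (hg.norm.pow 2).div hw fun r hr => (hpos r hr).ne'
    have := (hc.mono hKs).integrableOn_compact (μ := volume) hK
    exact this.of_forall_sdiff_eq_zero measurableSet_Ioi fun r hr => by simp [hg0 r hr.2]
  refine Integrable.mono' (hb.add (integrable_weight_sq hw hpos hφ))
    ((hg.aestronglyMeasurable measurableSet_Ioi).mul hm) ?_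
  filter_upwards [ae_restrict_mem measurableSet_Ioi] with r hr
  rw [norm_mul]
  exact amgm (hpos r hr)

theorem locallyIntegrableOn_cod {M : ℝ} (hM : 0 < M) (ψ : Cod M) :
    LocallyIntegrableOn ψ (Ioi (2 * M)) := by
  rw [locallyIntegrableOn_iff isOpen_Ioi.isLocallyClosed]
  intro K hKs hK
  have hw := continuousOn_f hM
  have hpos : ∀ r ∈ Ioi (2 * M), 0 < f M r := fun r hr => f_pos hM hr
  have hψ : MemLp ψ 2 (weighted M (f M)) := Lp.memLp ψ
  have hb : IntegrableOn (fun r => (1 : ℝ) ^ 2 / f M r) K :=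
    ((continuousOn_const.div hw fun r hr => (hpos r hr).ne').mono hKs).integrableOn_compact hK
  have hm : AEStronglyMeasurable ψ (volume.restrict (Ioi (2 * M))) :=
    hψ.1.mono_ac (ac_weighted hw hpos)
  refine Integrable.mono' (hb.add ((integrable_weight_sq hw hpos hψ).mono_set hKs))
    (hm.mono_set hKs) ?_
  filter_upwards [ae_restrict_mem hK.measurableSet] with r hr
  simpa using amgm (a := 1) (b := ‖ψ r‖) (hpos r (hKs hr))

/-! Regge–Wheeler operators -/

/-- Test functions on `(2M, ∞)`. -/
def IsTest (M : ℝ) (η : ℝ → ℝ) : Prop :=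
  ContDiff ℝ ((⊤ : ℕ∞) : WithTop ℕ∞) η ∧ HasCompactSupport η ∧ tsupport η ⊆ Ioi (2 * M)

/-- The zeroth order coefficient of `𝓓_s`:
`- (𝓑_l + (1 - s²) f₁) / r² + ω² / f`. -/
def potential (M : ℝ) (l : ℕ) (ω : ℂ) (s : ℕ) (r : ℝ) : ℂ :=
  -(1 / (r : ℂ) ^ 2) * (𝓑 l + (1 - (s : ℂ) ^ 2) * (f₁ M r : ℂ)) + ω ^ 2 / (f M r : ℂ)

/-- The formal expression `𝓓_s η = ∂ᵣ f ∂ᵣ η - (𝓑_l + (1 - s²) f₁) η / r² + ω² η / f`. -/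
def formal (M : ℝ) (l : ℕ) (ω : ℂ) (s : ℕ) (η : ℝ → ℝ) (r : ℝ) : ℂ :=
  ((deriv (fun x => f M x * deriv η x) r : ℝ) : ℂ) + potential M l ω s r * (η r : ℂ)

/-- `ψ = 𝓓_s φ` on `(2M, ∞)` in the sense of distributions
(`𝓓_s` is its own transpose for `∫ u v dr`). -/
def IsWeak (M : ℝ) (l : ℕ) (ω : ℂ) (s : ℕ) (φ ψ : ℝ → ℂ) : Prop :=
  ∀ η : ℝ → ℝ, IsTest M η →
    ∫ r in Ioi (2 * M), formal M l ω s η r * φ r = ∫ r in Ioi (2 * M), (η r : ℂ) * ψ r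

theorem formal_continuousOn {M : ℝ} (hM : 0 < M) (l : ℕ) (ω : ℂ) (s : ℕ) {η : ℝ → ℝ}
    (hη : IsTest M η) : ContinuousOn (formal M l ω s η) (Ioi (2 * M)) := by
  have hne : ∀ r ∈ Ioi (2 * M), r ≠ 0 := fun r hr => by
    have h : 2 * M < r := hr
    linarith
  have hf : ContDiffOn ℝ ((⊤ : ℕ∞) : WithTop ℕ∞) (fun x => f M x * deriv η x) (Ioi (2 * M)) := by
    refine ContDiffOn.mul (contDiffOn_const.sub (contDiffOn_const.div contDiffOn_id hne)) ?_
    exact ((contDiff_infty_iff_deriv.1 hη.1).2).contDiffOn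
  have hd := hf.continuousOn_deriv_of_isOpen isOpen_Ioi (by simp)
  have hr : ContinuousOn (fun r : ℝ => (r : ℂ)) (Ioi (2 * M)) :=
    Complex.continuous_ofReal.continuousOn
  have hfc : ContinuousOn (fun r : ℝ => (f M r : ℂ)) (Ioi (2 * M)) :=
    Complex.continuous_ofReal.comp_continuousOn (continuousOn_f hM)
  have hf1 : ContinuousOn (fun r : ℝ => (f₁ M r : ℂ)) (Ioi (2 * M)) :=
    Complex.continuous_ofReal.comp_continuousOn
      (continuousOn_const.div continuousOn_id hne)
  refine (Complex.continuous_ofReal.comp_continuousOn hd).add (ContinuousOn.mul ?_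
    (Complex.continuous_ofReal.comp_continuousOn hη.1.continuous.continuousOn))
  refine ContinuousOn.add (ContinuousOn.mul ?_ (continuousOn_const.add
    (continuousOn_const.mul hf1))) (continuousOn_const.div hfc fun r hr => ?_)
  · exact (continuousOn_const.div (hr.pow 2) fun r hr => by simpa using hne r hr).neg
  · exact_mod_cast (f_pos hM hr).ne'

theorem formal_eq_zero (M : ℝ) (l : ℕ) (ω : ℂ) (s : ℕ) (η : ℝ → ℝ) (r : ℝ)
    (hr : r ∉ tsupport η) : formal M l ω s η r = 0 := by
  have h0 : η =ᶠ[nhds r] 0 := notMem_tsupport_iff_eventuallyEq.1 hr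
  have h1 : (fun x => f M x * deriv η x) =ᶠ[nhds r] fun _ => 0 := by
    filter_upwards [h0.eventuallyEq_nhds] with x hx
    rw [hx.deriv_eq]; simp
  simp [formal, h1.deriv_eq, h0.eq_of_nhds]

theorem integrable_formal {M : ℝ} (hM : 0 < M) (l : ℕ) (ω : ℂ) (s : ℕ) {η : ℝ → ℝ}
    (hη : IsTest M η) (φ : Dom M) :
    IntegrableOn (fun r => formal M l ω s η r * φ r) (Ioi (2 * M)) :=
  integrable_mul ((continuousOn_f hM).inv₀ fun _ hr => (f_pos hM hr).ne')
    (fun _ hr => inv_pos.2 (f_pos hM hr)) (Lp.memLp φ) hη.2.1 hη.2.2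
    (formal_continuousOn hM l ω s hη) (formal_eq_zero M l ω s η)

theorem integrable_test {M : ℝ} (hM : 0 < M) {η : ℝ → ℝ} (hη : IsTest M η) (ψ : Cod M) :
    IntegrableOn (fun r => (η r : ℂ) * ψ r) (Ioi (2 * M)) :=
  integrable_mul (continuousOn_f hM) (fun _ hr => f_pos hM hr) (Lp.memLp ψ) hη.2.1 hη.2.2
    (Complex.continuous_ofReal.comp hη.1.continuous).continuousOn
    fun r hr => by simp [image_eq_zero_of_notMem_tsupport hr]

/-- The graph of `𝓓_s` as an operator from `L²(dr/f)` to `L²(f dr)` with its natural (maximal)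
domain: all `φ ∈ L²(dr/f)` whose distributional image `𝓓_s φ` lies in `L²(f dr)`. -/
def graph (M : ℝ) (hM : 0 < M) (l : ℕ) (ω : ℂ) (s : ℕ) : Submodule ℂ (Dom M × Cod M) where
  carrier := {p | IsWeak M l ω s p.1 p.2}
  zero_mem' := by
    intro η _
    have h1 : ((0 : Dom M) : ℝ → ℂ) =ᵐ[volume.restrict (Ioi (2 * M))] 0 :=
      (ac_dom hM).ae_le (Lp.coeFn_zero _ _ _)
    have h2 : ((0 : Cod M) : ℝ → ℂ) =ᵐ[volume.restrict (Ioi (2 * M))] 0 :=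
      (ac_cod hM).ae_le (Lp.coeFn_zero _ _ _)
    rw [integral_eq_zero_of_ae, integral_eq_zero_of_ae]
    · filter_upwards [h2] with r hr
      change (η r : ℂ) * (0 : Cod M) r = 0
      rw [hr, Pi.zero_apply, mul_zero]
    · filter_upwards [h1] with r hr
      change formal M l ω s η r * (0 : Dom M) r = 0
      rw [hr, Pi.zero_apply, mul_zero]
  add_mem' := by
    intro p q hp hq η hη
    have h1 : ((p.1 + q.1 : Dom M) : ℝ → ℂ) =ᵐ[volume.restrict (Ioi (2 * M))] p.1 + q.1 :=
      (ac_dom hM).ae_le (Lp.coeFn_add _ _)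
    have h2 : ((p.2 + q.2 : Cod M) : ℝ → ℂ) =ᵐ[volume.restrict (Ioi (2 * M))] p.2 + q.2 :=
      (ac_cod hM).ae_le (Lp.coeFn_add _ _)
    have e1 : ∫ r in Ioi (2 * M), formal M l ω s η r * (p.1 + q.1 : Dom M) r =
        (∫ r in Ioi (2 * M), formal M l ω s η r * p.1 r) +
          ∫ r in Ioi (2 * M), formal M l ω s η r * q.1 r := by
      rw [← integral_add (integrable_formal hM l ω s hη _) (integrable_formal hM l ω s hη _)]
      refine integral_congr_ae ?_
      filter_upwards [h1] with r hr
      simp only [hr, Pi.add_apply, mul_add]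
    have e2 : ∫ r in Ioi (2 * M), (η r : ℂ) * (p.2 + q.2 : Cod M) r =
        (∫ r in Ioi (2 * M), (η r : ℂ) * p.2 r) + ∫ r in Ioi (2 * M), (η r : ℂ) * q.2 r := by
      rw [← integral_add (integrable_test hM hη _) (integrable_test hM hη _)]
      refine integral_congr_ae ?_
      filter_upwards [h2] with r hr
      simp only [hr, Pi.add_apply, mul_add]
    change ∫ r in Ioi (2 * M), formal M l ω s η r * (p.1 + q.1 : Dom M) r =
      ∫ r in Ioi (2 * M), (η r : ℂ) * (p.2 + q.2 : Cod M) r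
    rw [e1, e2, hp η hη, hq η hη]
  smul_mem' := by
    intro c p hp η hη
    have h1 : ((c • p.1 : Dom M) : ℝ → ℂ) =ᵐ[volume.restrict (Ioi (2 * M))] c • ⇑p.1 :=
      (ac_dom hM).ae_le (Lp.coeFn_smul _ _)
    have h2 : ((c • p.2 : Cod M) : ℝ → ℂ) =ᵐ[volume.restrict (Ioi (2 * M))] c • ⇑p.2 :=
      (ac_cod hM).ae_le (Lp.coeFn_smul _ _)
    have e1 : ∫ r in Ioi (2 * M), formal M l ω s η r * (c • p.1 : Dom M) r =
        c * ∫ r in Ioi (2 * M), formal M l ω s η r * p.1 r := by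
      rw [← integral_const_mul]
      refine integral_congr_ae ?_
      filter_upwards [h1] with r hr
      simp only [hr, Pi.smul_apply, smul_eq_mul]; ring
    have e2 : ∫ r in Ioi (2 * M), (η r : ℂ) * (c • p.2 : Cod M) r =
        c * ∫ r in Ioi (2 * M), (η r : ℂ) * p.2 r := by
      rw [← integral_const_mul]
      refine integral_congr_ae ?_
      filter_upwards [h2] with r hr
      simp only [hr, Pi.smul_apply, smul_eq_mul]; ring
    change ∫ r in Ioi (2 * M), formal M l ω s η r * (c • p.1 : Dom M) r =
      ∫ r in Ioi (2 * M), (η r : ℂ) * (c • p.2 : Cod M) r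
    rw [e1, e2, hp η hη]

/-- The graph is single valued, so that the operator below has exactly this graph. -/
theorem graph_single_valued (M : ℝ) (hM : 0 < M) (l : ℕ) (ω : ℂ) (s : ℕ)
    (x : Dom M × Cod M) (hx : x ∈ graph M hM l ω s) (h0 : x.1 = 0) : x.2 = 0 := by
  have hz : ∀ η : ℝ → ℝ, IsTest M η → ∫ r in Ioi (2 * M), (η r : ℂ) * x.2 r = 0 := by
    intro η hη
    rw [← hx η hη, h0, integral_eq_zero_of_ae]
    have h1 : ((0 : Dom M) : ℝ → ℂ) =ᵐ[volume.restrict (Ioi (2 * M))] 0 :=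
      (ac_dom hM).ae_le (Lp.coeFn_zero _ _ _)
    filter_upwards [h1] with r hr
    simp only [hr, Pi.zero_apply, mul_zero]
  have key := isOpen_Ioi.ae_eq_zero_of_integral_contDiff_smul_eq_zero
    (locallyIntegrableOn_cod hM x.2) (fun g h1 h2 h3 => by
      have := hz g ⟨h1, h2, h3⟩
      rw [setIntegral_eq_integral_of_forall_compl_eq_zero] at this
      · simpa [Complex.real_smul] using this
      · intro r hr
        simp [image_eq_zero_of_notMem_tsupport fun h => hr (h3 h)])
  refine (Lp.eq_zero_iff_ae_eq_zero).2 ((weighted_ac M _).ae_le ?_)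
  exact (ae_restrict_iff' measurableSet_Ioi).2 key

/-- The spin-`s` Regge–Wheeler operator `𝓓_s` as an unbounded operator from `L²(2M, ∞; dr/f)`
to `L²(2M, ∞; f dr)`. -/
def 𝓓 (M : ℝ) (hM : 0 < M) (l : ℕ) (ω : ℂ) (s : ℕ) : Dom M →ₗ.[ℂ] Cod M :=
  (graph M hM l ω s).toLinearPMap

/-! Multiplication operators and operator matrices -/

/-- Multiplication by the function `v`, as an operator from `L²(2M, ∞; dr/f)` to
`L²(2M, ∞; f dr)`, with domain all `φ` for which `v φ ∈ L²(2M, ∞; f dr)`. -/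
def mulOp (M : ℝ) (hM : 0 < M) (v : ℝ → ℂ) : Dom M →ₗ.[ℂ] Cod M where
  domain :=
    { carrier := {φ | MemLp (fun r => v r * φ r) 2 (μcod M)}
      zero_mem' := by
        refine (memLp_congr_ae ?_).2 (MemLp.zero (ε := ℂ))
        filter_upwards [((weighted_ac M _).trans (ac_dom hM)).ae_le (Lp.coeFn_zero ℂ 2 (μdom M))]
          with r hr
        simp only [hr, Pi.zero_apply, mul_zero]
      add_mem' := by
        intro φ χ h1 h2
        refine (memLp_congr_ae ?_).2 (h1.add h2)
        filter_upwards [((weighted_ac M _).trans (ac_dom hM)).ae_le (Lp.coeFn_add φ χ)]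
          with r hr
        simp only [hr, Pi.add_apply, mul_add]
      smul_mem' := by
        intro c φ h
        refine (memLp_congr_ae ?_).2 (h.const_smul c)
        filter_upwards [((weighted_ac M _).trans (ac_dom hM)).ae_le (Lp.coeFn_smul c φ)]
          with r hr
        simp only [hr, Pi.smul_apply, smul_eq_mul]; ring }
  toFun :=
    { toFun := fun φ => MemLp.toLp (fun r => v r * (φ : Dom M) r) φ.2
      map_add' := by
        rintro ⟨φ, h1⟩ ⟨χ, h2⟩
        refine Eq.trans (MemLp.toLp_congr _ (h1.add h2) ?_) (MemLp.toLp_add h1 h2)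
        filter_upwards [((weighted_ac M _).trans (ac_dom hM)).ae_le (Lp.coeFn_add φ χ)]
          with r hr
        change v r * (φ + χ : Dom M) r = v r * φ r + v r * χ r
        rw [hr, Pi.add_apply, mul_add]
      map_smul' := by
        rintro c ⟨φ, h⟩
        refine Eq.trans (MemLp.toLp_congr _ (h.const_smul c) ?_) (MemLp.toLp_const_smul c h)
        filter_upwards [((weighted_ac M _).trans (ac_dom hM)).ae_le (Lp.coeFn_smul c φ)]
          with r hr
        simp only [SetLike.mk_smul_mk, hr, Pi.smul_apply, smul_eq_mul]; ring }

/-- The Hilbert direct sum `L²(2M, ∞; dr/f)^{⊕n}`. -/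
abbrev DomN (M : ℝ) (n : ℕ) : Type := PiLp 2 fun _ : Fin n => Dom M

/-- The Hilbert direct sum `L²(2M, ∞; f dr)^{⊕n}`. -/
abbrev CodN (M : ℝ) (n : ℕ) : Type := PiLp 2 fun _ : Fin n => Cod M

/-- The operator matrix `(A φ)ᵢ = ∑ⱼ Aᵢⱼ φⱼ`, defined for those `φ` whose components `φⱼ` lie in
the domains of all the entries `Aᵢⱼ`. -/
def opMatrix {M : ℝ} {n : ℕ} (A : Matrix (Fin n) (Fin n) (Dom M →ₗ.[ℂ] Cod M)) :
    DomN M n →ₗ.[ℂ] CodN M n where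
  domain :=
    { carrier := {φ | ∀ i j, φ j ∈ (A i j).domain}
      zero_mem' := fun i j => (A i j).domain.zero_mem
      add_mem' := fun h1 h2 i j => (A i j).domain.add_mem (h1 i j) (h2 i j)
      smul_mem' := fun c _ h i j => (A i j).domain.smul_mem c (h i j) }
  toFun :=
    { toFun := fun φ => WithLp.toLp 2 fun i => ∑ j, A i j ⟨(φ : DomN M n) j, φ.2 i j⟩
      map_add' := by
        rintro ⟨φ, h1⟩ ⟨χ, h2⟩
        ext1 i
        change ∑ j : Fin n, A i j _ = ∑ j : Fin n, A i j _ + ∑ j : Fin n, A i j _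
        rw [← Finset.sum_add_distrib]
        exact Finset.sum_congr rfl fun j _ => (A i j).map_add ⟨φ j, h1 i j⟩ ⟨χ j, h2 i j⟩
      map_smul' := by
        rintro c ⟨φ, h⟩
        ext1 i
        change ∑ j : Fin n, A i j _ = c • ∑ j : Fin n, A i j _
        rw [Finset.smul_sum]
        exact Finset.sum_congr rfl fun j _ => (A i j).map_smul c ⟨φ j, h i j⟩ }

/-- The unbounded operator `T` has a bounded (everywhere defined) inverse. -/
def HasBoundedInverse {E F : Type*} [NormedAddCommGroup E] [NormedSpace ℂ E]
    [NormedAddCommGroup F] [NormedSpace ℂ F] (T : E →ₗ.[ℂ] F) : Prop :=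
  ∃ R : F →L[ℂ] E,
    (∀ ψ : F, ∃ h : R ψ ∈ T.domain, T ⟨R ψ, h⟩ = ψ) ∧ ∀ φ : T.domain, R (T φ) = φ

/-! The triangular Regge–Wheeler systems -/

section systems

variable (M : ℝ) (hM : 0 < M) (l : ℕ) (ω : ℂ)

/-- The function `(f₁ / r²) (𝓑_l + f₁ / 2)`. -/
def coupling₀ (r : ℝ) : ℂ := (f₁ M r : ℂ) / (r : ℂ) ^ 2 * (𝓑 l + 1 / 2 * (f₁ M r : ℂ))

/-- The function `𝓑_l² f₁ / r²`. -/
def coupling₁ (r : ℝ) : ℂ := 𝓑 l ^ 2 * ((f₁ M r : ℂ) / (r : ℂ) ^ 2)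

/-- The function `(f₁² / (8 r²)) (7 𝓑_l + 2)`. -/
def coupling₂ (r : ℝ) : ℂ := (f₁ M r : ℂ) ^ 2 / (8 * (r : ℂ) ^ 2) * (7 * 𝓑 l + 2)

/-- Scalar wave equation. -/
def scalarSystem : Matrix (Fin 1) (Fin 1) (Dom M →ₗ.[ℂ] Cod M) :=
  (1 / ω ^ 2) • !![𝓓 M hM l ω 0]

/-- Vector wave equation, odd sector. -/
def vectorOddSystem : Matrix (Fin 1) (Fin 1) (Dom M →ₗ.[ℂ] Cod M) :=
  (𝓑 l / ω ^ 2) • !![𝓓 M hM l ω 1]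

/-- Vector wave equation, even sector. -/
def vectorEvenSystem : Matrix (Fin 3) (Fin 3) (Dom M →ₗ.[ℂ] Cod M) :=
  (1 / ω ^ 2) • !![
    𝓓 M hM l ω 0, 0, mulOp M hM fun r => -coupling₀ M l r;
    0, 𝓑 l • 𝓓 M hM l ω 1, 0;
    0, 0, 𝓓 M hM l ω 0]

/-- Lichnerowicz wave equation, odd sector. -/
def lichOddSystem : Matrix (Fin 3) (Fin 3) (Dom M →ₗ.[ℂ] Cod M) :=
  (-2 / ω ^ 2) • !![
    𝓑 l • 𝓓 M hM l ω 1, 0, mulOp M hM fun r => 1 / 3 * coupling₁ M l r;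
    0, 𝓐 l • 𝓓 M hM l ω 2, 0;
    0, 0, 𝓑 l • 𝓓 M hM l ω 1]

/-- Lichnerowicz wave equation, even sector. -/
def lichEvenSystem : Matrix (Fin 7) (Fin 7) (Dom M →ₗ.[ℂ] Cod M) :=
  (-2 / ω ^ 2) • !![
    𝓓 M hM l ω 0, 0, mulOp M hM fun r => -coupling₀ M l r, 0,
      mulOp M hM fun r => coupling₀ M l r, 0, mulOp M hM fun r => coupling₂ M l r;
    0, 𝓑 l • 𝓓 M hM l ω 1, 0, 0, 0, mulOp M hM fun r => -(5 / 3) * coupling₁ M l r, 0;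
    0, 0, 𝓓 M hM l ω 0, 0, 0, 0, mulOp M hM fun r => coupling₀ M l r;
    0, 0, 0, (α M l ω * 𝓐 l) • 𝓓 M hM l ω 2, 0, 0, 0;
    0, 0, 0, 0, 𝓓 M hM l ω 0, 0, mulOp M hM fun r => -coupling₀ M l r;
    0, 0, 0, 0, 0, 𝓑 l • 𝓓 M hM l ω 1, 0;
    0, 0, 0, 0, 0, 0, 𝓓 M hM l ω 0]

end systems

end ReggeWheeler

end

noncomputable section

namespace ReggeWheeler

open MeasureTheory Set

/-! Each system is `D + K`, where `D` is the diagonal part and `K` is strictly upper triangular. The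
entries of `K` are multiplications by polynomials in `1 / r`. These are bounded on `(2M, ∞)`, and `f
≤ 1` makes `L²(dr/f)` embed contractively in `L²(f dr)`, so `K` is bounded and everywhere defined.
Hence the domain of the matrix is the product of the diagonal domains.

If `D` has bounded inverse `S`, then `N = S K` is bounded and strictly upper triangular, hence
nilpotent, so `1 + N` is invertible and `(1 + N)⁻¹ S` inverts `D + K = D (1 + N)`. This is
`hasBoundedInverse_opMatrix`; `isBoundedPMap_mulOp_polynomial` supplies the bounds. What remains is
that the scalars multiplying the `𝓓 s` on the diagonal do not vanish. -/

theorem HasBoundedInverse.smul {E F : Type*} [NormedAddCommGroup E] [NormedSpace ℂ E]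
    [NormedAddCommGroup F] [NormedSpace ℂ F] {T : E →ₗ.[ℂ] F} (hT : HasBoundedInverse T)
    {c : ℂ} (hc : c ≠ 0) : HasBoundedInverse (c • T) := by
  obtain ⟨R, h1, h2⟩ := hT
  refine ⟨c⁻¹ • R, fun ψ => ?_, fun φ => ?_⟩
  · obtain ⟨h, e⟩ := h1 (c⁻¹ • ψ)
    rw [map_smul] at h
    refine ⟨h, ?_⟩
    have e' : T ⟨(c⁻¹ • R) ψ, h⟩ = c⁻¹ • ψ := by
      rw [← e]; congr 2; simp
    change c • T ⟨(c⁻¹ • R) ψ, h⟩ = ψ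
    rw [e', smul_inv_smul₀ hc]
  · change c⁻¹ • R (c • T φ) = φ
    rw [map_smul, h2 φ, inv_smul_smul₀ hc]

/-- The operator `T` is everywhere defined and bounded. -/
def IsBoundedPMap {E F : Type*} [NormedAddCommGroup E] [NormedSpace ℂ E]
    [NormedAddCommGroup F] [NormedSpace ℂ F] (T : E →ₗ.[ℂ] F) : Prop :=
  T.domain = ⊤ ∧ ∃ K : E →L[ℂ] F, ∀ x : T.domain, T x = K x

theorem IsBoundedPMap.zero {E F : Type*} [NormedAddCommGroup E] [NormedSpace ℂ E]
    [NormedAddCommGroup F] [NormedSpace ℂ F] : IsBoundedPMap (0 : E →ₗ.[ℂ] F) :=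
  ⟨rfl, 0, fun _ => rfl⟩

theorem IsBoundedPMap.smul {E F : Type*} [NormedAddCommGroup E] [NormedSpace ℂ E]
    [NormedAddCommGroup F] [NormedSpace ℂ F] {T : E →ₗ.[ℂ] F} (hT : IsBoundedPMap T) (c : ℂ) :
    IsBoundedPMap (c • T) := by
  obtain ⟨h, K, hK⟩ := hT
  refine ⟨h, c • K, fun x => ?_⟩
  change c • T x = c • K x
  rw [hK x]

theorem smul_zero_pmap {E F : Type*} [NormedAddCommGroup E] [NormedSpace ℂ E]
    [NormedAddCommGroup F] [NormedSpace ℂ F] (c : ℂ) : c • (0 : E →ₗ.[ℂ] F) = 0 :=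
  LinearPMap.ext' (smul_zero c)

/-! ### Inversion of triangular operator matrices -/

/-- A linear endomorphism of a finite direct sum that is strictly upper triangular is nilpotent. -/
theorem isNilpotent_of_strictUpper {E : Type*} [NormedAddCommGroup E] [NormedSpace ℂ E] {n : ℕ}
    (N : (PiLp 2 fun _ : Fin n => E) →L[ℂ] (PiLp 2 fun _ : Fin n => E))
    (hN : ∀ φ i, (∀ j, i < j → φ j = 0) → N φ i = 0) : IsNilpotent N := by
  -- Each application of `N` kills one more component, counted from the bottom: the last `k`
  -- components of `(N ^ k) φ` vanish.
  have key : ∀ k φ (i : Fin n), n ≤ i + k → (N ^ k) φ i = 0 := by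
    intro k
    induction k with
    | zero => intro φ i h; exact absurd i.2 (by omega)
    | succ k ih =>
      intro φ i h
      rw [pow_succ']
      refine hN _ _ fun j hj => ih φ j ?_
      have : (i : ℕ) < j := hj
      omega
  refine ⟨n, ?_⟩
  ext φ i : 2
  exact key n φ i (by omega)

/-- An upper triangular operator matrix has a bounded inverse if its diagonal entries do and its
entries above the diagonal are bounded. -/
theorem hasBoundedInverse_opMatrix {M : ℝ} {n : ℕ}
    {A : Matrix (Fin n) (Fin n) (Dom M →ₗ.[ℂ] Cod M)}
    (diag : ∀ i, HasBoundedInverse (A i i)) (upper : ∀ i j, i < j → IsBoundedPMap (A i j))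
    (lower : ∀ i j, j < i → A i j = 0) : HasBoundedInverse (opMatrix A) := by
  choose B hB1 hB2 using diag
  -- The off-diagonal part as a full matrix of bounded operators. It is set to zero on the diagonal,
  -- where `A i i` may be unbounded, so that sums can run over all `j`.
  have hK : ∀ i j, ∃ K : Dom M →L[ℂ] Cod M, (j ≤ i → K = 0) ∧
      (i ≠ j → (A i j).domain = ⊤ ∧ ∀ x : (A i j).domain, A i j x = K x) := by
    intro i j
    rcases lt_trichotomy i j with h | rfl | h
    · obtain ⟨h1, K, h2⟩ := upper i j h
      exact ⟨K, fun h' => absurd h (not_lt.2 h'), fun _ => ⟨h1, h2⟩⟩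
    · exact ⟨0, fun _ => rfl, fun h => absurd rfl h⟩
    · refine ⟨0, fun _ => rfl, fun _ => ?_⟩
      rw [lower i j h]
      exact ⟨rfl, fun _ => rfl⟩
  choose K hK0 hK1 using hK
  have hA : ∀ (φ : (opMatrix A).domain) (i : Fin n),
      opMatrix A φ i = A i i ⟨(φ : DomN M n) i, φ.2 i i⟩ + ∑ j, K i j ((φ : DomN M n) j) := by
    intro φ i
    change ∑ j, A i j ⟨(φ : DomN M n) j, φ.2 i j⟩ = _
    rw [← Finset.add_sum_erase _ _ (Finset.mem_univ i),
      ← Finset.add_sum_erase _ (fun j => K i j _) (Finset.mem_univ i), hK0 i i le_rfl]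
    simp only [_root_.zero_apply, zero_add]
    congr 1
    refine Finset.sum_congr rfl fun j hj => ?_
    exact (hK1 i j (Finset.ne_of_mem_erase hj).symm).2 _
  -- `S` is the inverse of the diagonal part, and `N` below is `S` composed with the off-diagonal
  -- part.
  let S : CodN M n →L[ℂ] DomN M n :=
    ((PiLp.continuousLinearEquiv 2 ℂ fun _ : Fin n => Dom M).symm :
      (Fin n → Dom M) →L[ℂ] DomN M n).comp
      (ContinuousLinearMap.pi fun i => (B i).comp (PiLp.proj 2 (fun _ : Fin n => Cod M) i))
  let N : DomN M n →L[ℂ] DomN M n :=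
    ((PiLp.continuousLinearEquiv 2 ℂ fun _ : Fin n => Dom M).symm :
      (Fin n → Dom M) →L[ℂ] DomN M n).comp
      (ContinuousLinearMap.pi fun i =>
        (B i).comp (∑ j, (K i j).comp (PiLp.proj 2 (fun _ : Fin n => Dom M) j)))
  have hS : ∀ ψ i, S ψ i = B i (ψ i) := fun ψ i => rfl
  have hN : ∀ φ i, N φ i = B i (∑ j, K i j (φ j)) := by
    intro φ i
    change B i ((∑ j, (K i j).comp (PiLp.proj 2 (fun _ : Fin n => Dom M) j)) φ) = _
    rw [_root_.sum_apply]
    rfl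
  have hnil : IsNilpotent N := by
    refine isNilpotent_of_strictUpper N fun φ i h => ?_
    rw [hN, Finset.sum_eq_zero, map_zero]
    intro j _
    rcases lt_or_ge i j with hj | hj
    · rw [h j hj, map_zero]
    · rw [hK0 i j hj, _root_.zero_apply]
  obtain ⟨u, hu⟩ := hnil.isUnit_one_add
  refine ⟨(↑u⁻¹ : DomN M n →L[ℂ] DomN M n).comp S, fun ψ => ?_, fun φ => ?_⟩
  · set φ : DomN M n := ((↑u⁻¹ : DomN M n →L[ℂ] DomN M n).comp S) ψ with hφ
    have h1 : (1 + N) φ = S ψ := by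
      have h : ((u : DomN M n →L[ℂ] DomN M n) * ↑u⁻¹) (S ψ) = S ψ := by rw [u.mul_inv]; rfl
      rw [← hu]
      exact h
    -- Back substitution: being in the range of `B i` is what puts `φ i` in the domain of the
    -- unbounded entry `A i i`.
    have h2 : ∀ i, φ i = B i (ψ i - ∑ j, K i j (φ j)) := by
      intro i
      have h : φ i + N φ i = S ψ i := congrArg (fun x : DomN M n => x i) h1
      rw [hS, hN] at h
      rw [map_sub, ← h, add_sub_cancel_right]
    have hd : φ ∈ (opMatrix A).domain := by
      intro i j
      by_cases hij : i = j
      · subst hij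
        rw [h2 i]
        exact (hB1 i _).1
      · rw [(hK1 i j hij).1]
        trivial
    refine ⟨hd, ?_⟩
    ext1 i
    rw [hA]
    obtain ⟨h, e⟩ := hB1 i (ψ i - ∑ j, K i j (φ j))
    have : A i i ⟨φ i, hd i i⟩ = ψ i - ∑ j, K i j (φ j) := by
      rw [← e]
      congr 2
      exact h2 i
    rw [this, sub_add_cancel]
  · have h : S (opMatrix A φ) = (1 + N) φ := by
      ext1 i
      change _ = (φ : DomN M n) i + N φ i
      rw [hS, hN, hA, map_add, hB2]
    change (↑u⁻¹ : DomN M n →L[ℂ] DomN M n) (S (opMatrix A φ)) = φ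
    rw [h, ← hu]
    change ((↑u⁻¹ : DomN M n →L[ℂ] DomN M n) * u) φ = φ
    rw [u.inv_mul]
    rfl

/-! ### Boundedness of the couplings -/

/-- Since `0 < f ≤ 1` outside the horizon, `f ≤ 1 ≤ 1 / f`. This lets bounded multipliers map the
domain space into the target space. -/
theorem μcod_le_μdom {M : ℝ} (hM : 0 < M) : μcod M ≤ μdom M := by
  refine withDensity_mono ?_
  filter_upwards [ae_restrict_mem measurableSet_Ioi] with r hr
  have h : 2 * M < r := hr
  have h0 : f M r ≤ 1 := by
    have : 0 ≤ 2 * M / r := div_nonneg (by linarith) (by linarith)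
    unfold f
    linarith
  exact ENNReal.ofReal_le_ofReal (h0.trans ((one_le_inv₀ (f_pos hM hr)).2 h0))

/-- Multiplication by a bounded continuous function is a bounded operator from `L²(dr/f)` to
`L²(f dr)`. -/
theorem isBoundedPMap_mulOp {M : ℝ} (hM : 0 < M) {v : ℝ → ℂ}
    (hv : ContinuousOn v (Ioi (2 * M))) {C : ℝ} (hC : ∀ r ∈ Ioi (2 * M), ‖v r‖ ≤ C) :
    IsBoundedPMap (mulOp M hM v) := by
  have hm : ∀ φ : Dom M, AEStronglyMeasurable (fun r => v r * φ r) (μcod M) := fun φ =>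
    ((hv.aestronglyMeasurable measurableSet_Ioi).mono_ac (weighted_ac M _)).mul
      ((Lp.aestronglyMeasurable φ).mono_measure (μcod_le_μdom hM))
  have hb : ∀ φ : Dom M, ∀ᵐ r ∂μcod M, ‖v r * φ r‖ ≤ C * ‖φ r‖ := by
    intro φ
    refine (weighted_ac M _).ae_le ?_
    filter_upwards [ae_restrict_mem measurableSet_Ioi] with r hr
    rw [norm_mul]
    exact mul_le_mul_of_nonneg_right (hC r hr) (norm_nonneg _)
  have htop : (mulOp M hM v).domain = ⊤ := by
    refine eq_top_iff.2 fun φ _ => ?_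
    exact MemLp.of_le_mul ((Lp.memLp φ).mono_measure (μcod_le_μdom hM)) (hm φ) (hb φ)
  have hC0 : 0 ≤ C :=
    (norm_nonneg _).trans (hC (2 * M + 1) (by rw [mem_Ioi]; linarith))
  -- As the domain is everything, restricting the codomain of the identity to it turns `mulOp` into
  -- a total linear map.
  refine ⟨htop, LinearMap.mkContinuous ((mulOp M hM v).toFun.comp
    (LinearMap.codRestrict _ LinearMap.id fun φ => htop ▸ Submodule.mem_top)) C ?_,
    fun x => rfl⟩
  intro φ
  have hmem : MemLp (fun r => v r * φ r) 2 (μcod M) :=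
    MemLp.of_le_mul ((Lp.memLp φ).mono_measure (μcod_le_μdom hM)) (hm φ) (hb φ)
  change ‖hmem.toLp _‖ ≤ C * ‖φ‖
  rw [Lp.norm_toLp, Lp.norm_def, ← ENNReal.toReal_ofReal hC0, ← ENNReal.toReal_mul]
  refine ENNReal.toReal_mono (ENNReal.mul_ne_top ENNReal.ofReal_ne_top (Lp.eLpNorm_ne_top φ)) ?_
  exact (eLpNorm_le_mul_eLpNorm_of_ae_le_mul (hb φ) 2).trans
    (mul_le_mul_right (eLpNorm_mono_measure _ (μcod_le_μdom hM)) _)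

/-- Multiplication by a polynomial in `1 / r` is bounded on `(2M, ∞)`. -/
theorem isBoundedPMap_mulOp_polynomial {M : ℝ} (hM : 0 < M) (p : Polynomial ℂ) {v : ℝ → ℂ}
    (hv : ∀ r, v r = p.eval ((r : ℂ)⁻¹)) : IsBoundedPMap (mulOp M hM v) := by
  obtain rfl : v = fun r : ℝ => p.eval ((r : ℂ)⁻¹) := funext hv
  have hcont : ContinuousOn (fun r : ℝ => (r : ℂ)⁻¹) (Ioi (2 * M)) :=
    Complex.continuous_ofReal.continuousOn.inv₀ fun r hr => by
      have h : 2 * M < r := hr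
      exact_mod_cast (by linarith : (0 : ℝ) < r).ne'
  -- For `r > 2M` the point `1 / r` stays in this compact ball, where `p` is bounded.
  obtain ⟨C, hC⟩ := (isCompact_closedBall (0 : ℂ) (2 * M)⁻¹).exists_bound_of_continuousOn
    p.continuous.continuousOn
  refine isBoundedPMap_mulOp hM (p.continuous.comp_continuousOn hcont) (C := C) fun r hr => ?_
  have h : 2 * M < r := hr
  refine hC _ ?_
  rw [mem_closedBall_zero_iff, norm_inv, Complex.norm_real, Real.norm_of_nonneg (by linarith)]
  exact inv_anti₀ (by linarith) h.le

section couplings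

open Polynomial

/-- With `X = 1 / r` one has `f₁ = 2 M X`, so `f₁ / r² = 2 M X³`. The factor `c` absorbs the signs
and constants in the systems. -/
theorem isBoundedPMap_coupling₀ {M : ℝ} (hM : 0 < M) (l : ℕ) (c : ℂ) :
    IsBoundedPMap (mulOp M hM fun r => c * coupling₀ M l r) :=
  isBoundedPMap_mulOp_polynomial hM
    (C (2 * c * M) * X ^ 3 * (C (𝓑 l) + C (M : ℂ) * X)) fun r => by
      simp [coupling₀, f₁]; ring

theorem isBoundedPMap_coupling₁ {M : ℝ} (hM : 0 < M) (l : ℕ) (c : ℂ) :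
    IsBoundedPMap (mulOp M hM fun r => c * coupling₁ M l r) :=
  isBoundedPMap_mulOp_polynomial hM (C (2 * c * 𝓑 l ^ 2 * M) * X ^ 3) fun r => by
    simp [coupling₁, f₁]; ring

theorem isBoundedPMap_coupling₂ {M : ℝ} (hM : 0 < M) (l : ℕ) :
    IsBoundedPMap (mulOp M hM fun r => coupling₂ M l r) :=
  isBoundedPMap_mulOp_polynomial hM (C ((M : ℂ) ^ 2 / 2 * (7 * 𝓑 l + 2)) * X ^ 4) fun r => by
    simp [coupling₂, f₁]; ring

end couplings

/-! ### Nonvanishing of the diagonal factors -/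

theorem 𝓑_ne_zero {l : ℕ} (hl : 1 ≤ l) : 𝓑 l ≠ 0 := by
  unfold 𝓑
  norm_cast
  positivity

theorem 𝓐_ne_zero {l : ℕ} (hl : 2 ≤ l) : 𝓐 l ≠ 0 := by
  -- Writing `l = 2 + k` turns `l - 1` into `k + 1`, so the product is the cast of a positive
  -- natural number.
  obtain ⟨k, rfl⟩ := Nat.exists_eq_add_of_le hl
  have h : 𝓐 (2 + k) = (((k + 1) * (k + 2) * (k + 3) * (k + 4) : ℕ) : ℂ) := by
    unfold 𝓐
    push_cast
    ring
  rw [h]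
  norm_cast

/-- The triangular criterion is insensitive to a nonzero overall factor. -/
theorem hasBoundedInverse_opMatrix_smul {M : ℝ} {n : ℕ} {c : ℂ} (hc : c ≠ 0)
    {A : Matrix (Fin n) (Fin n) (Dom M →ₗ.[ℂ] Cod M)}
    (diag : ∀ i, HasBoundedInverse (A i i)) (upper : ∀ i j, i < j → IsBoundedPMap (A i j))
    (lower : ∀ i j, j < i → A i j = 0) : HasBoundedInverse (opMatrix (c • A)) := by
  refine hasBoundedInverse_opMatrix (fun i => (diag i).smul hc)
    (fun i j h => (upper i j h).smul c) fun i j h => ?_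
  rw [Matrix.smul_apply, lower i j h, smul_zero_pmap]

end ReggeWheeler

end

/-! ### The five systems -/

open ReggeWheeler in
theorem corollary2p2 (M : ℝ) (hM : 0 < M) (l : ℕ) (ω : ℂ) (hω : ω ≠ 0) :
    (HasBoundedInverse (𝓓 M hM l ω 0) →
      HasBoundedInverse (opMatrix (scalarSystem M hM l ω))) ∧
    (1 ≤ l → HasBoundedInverse (𝓓 M hM l ω 1) →
      HasBoundedInverse (opMatrix (vectorOddSystem M hM l ω))) ∧
    (1 ≤ l → HasBoundedInverse (𝓓 M hM l ω 0) → HasBoundedInverse (𝓓 M hM l ω 1) →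
      HasBoundedInverse (opMatrix (vectorEvenSystem M hM l ω))) ∧
    (2 ≤ l → HasBoundedInverse (𝓓 M hM l ω 1) → HasBoundedInverse (𝓓 M hM l ω 2) →
      HasBoundedInverse (opMatrix (lichOddSystem M hM l ω))) ∧
    (2 ≤ l → α M l ω ≠ 0 → HasBoundedInverse (𝓓 M hM l ω 0) →
      HasBoundedInverse (𝓓 M hM l ω 1) → HasBoundedInverse (𝓓 M hM l ω 2) →
      HasBoundedInverse (opMatrix (lichEvenSystem M hM l ω))) := by
  have c0 : IsBoundedPMap (mulOp M hM fun r => coupling₀ M l r) := by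
    simpa only [one_mul] using isBoundedPMap_coupling₀ hM l 1
  have c0' : IsBoundedPMap (mulOp M hM fun r => -coupling₀ M l r) := by
    simpa only [neg_one_mul] using isBoundedPMap_coupling₀ hM l (-1)
  have z : IsBoundedPMap (0 : Dom M →ₗ.[ℂ] Cod M) := IsBoundedPMap.zero
  have h1 : 1 / ω ^ 2 ≠ 0 := div_ne_zero one_ne_zero (pow_ne_zero 2 hω)
  have h2 : -2 / ω ^ 2 ≠ 0 := div_ne_zero (by norm_num) (pow_ne_zero 2 hω)
  refine ⟨fun d0 => ?_, fun hl d1 => ?_, fun hl d0 d1 => ?_, fun hl d1 d2 => ?_,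
    fun hl hα d0 d1 d2 => ?_⟩
  · refine hasBoundedInverse_opMatrix_smul h1 (fun i => ?_) (fun i j h => ?_) fun i j h => ?_
    · fin_cases i; exact d0
    · omega
    · omega
  · refine hasBoundedInverse_opMatrix_smul (div_ne_zero (𝓑_ne_zero hl) (pow_ne_zero 2 hω))
      (fun i => ?_) (fun i j h => ?_) fun i j h => ?_
    · fin_cases i; exact d1
    · omega
    · omega
  -- With the overall factor pulled out, every diagonal or upper entry matches a fact in context,
  -- which `assumption` finds; lower entries are zero by `rfl`.
  · have d1' := d1.smul (𝓑_ne_zero hl)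
    refine hasBoundedInverse_opMatrix_smul h1 (fun i => ?_) (fun i j h => ?_) fun i j h => ?_
    · fin_cases i <;> assumption
    · fin_cases i <;> fin_cases j <;> first | exact absurd h (by decide) | assumption
    · fin_cases i <;> fin_cases j <;> first | exact absurd h (by decide) | rfl
  · have d1' := d1.smul (𝓑_ne_zero (one_le_two.trans hl))
    have d2' := d2.smul (𝓐_ne_zero hl)
    have c1 := isBoundedPMap_coupling₁ hM l (1 / 3)
    refine hasBoundedInverse_opMatrix_smul h2 (fun i => ?_) (fun i j h => ?_) fun i j h => ?_
    · fin_cases i <;> assumption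
    · fin_cases i <;> fin_cases j <;> first | exact absurd h (by decide) | assumption
    · fin_cases i <;> fin_cases j <;> first | exact absurd h (by decide) | rfl
  · have d1' := d1.smul (𝓑_ne_zero (one_le_two.trans hl))
    -- Excluding the algebraically special frequencies is needed for the spin-2 entry, whose factor
    -- is `α * 𝓐`.
    have d2' := d2.smul (mul_ne_zero hα (𝓐_ne_zero hl))
    have c1 := isBoundedPMap_coupling₁ hM l (-(5 / 3))
    have c2 := isBoundedPMap_coupling₂ hM l
    refine hasBoundedInverse_opMatrix_smul h2 (fun i => ?_) (fun i j h => ?_) fun i j h => ?_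
    · fin_cases i <;> assumption
    · fin_cases i <;> fin_cases j <;> first | exact absurd h (by decide) | assumption
    · fin_cases i <;> fin_cases j <;> first | exact absurd h (by decide) | rfl
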